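/- Let $(R,\mathfrak m,k)$ be a Cohen–Macaulay local (Noetherian) ring with a canonical module $\omega_R$, that is, a maximal Cohen–Macaulay module of type $1$ and of finite injective dimension. Let $I$ be a Cohen–Macaulay ideal of $R$, i.e. an ideal such that $R/I$ is a (nonzero) Cohen–Macaulay $R$-module; if $R$ is Gorenstein, assume moreover that $I\neq 0$. For a finitely generated module $M$ over a local ring $S$ put $\delta_S(M)=\mu_S(M/M^{\mathrm{cm}})$, where $\mu_S$ is the minimal number of generators and $M^{\mathrm{cm}}$ is the sum of all submodules $\varphi(L)\subseteq M$, with $L$ a maximal Cohen–Macaulay $S$-module without nonzero free direct summands and $\varphi\colon L\to M$ an $S$-linear map. Then there is a Cohen–Macaulay ideal $J\subseteq I$ of $R$ such that, for all $i\ge 0$, $J$ annihilates $\operatorname{Ext}^i_R(R/I,\omega_R)$ and $$\delta_{R/J}\bigl(\operatorname{Ext}^i_R(R/I,\omega_R)\bigr)=0 .$$ In particular, for the same $J$: if $s=\mu_R(I)-\operatorname{ht}(I)$ and $H_s(I,\omega_R)$ is the $s$-th homology of the Koszul complex of a minimal system of generators of $I$ with coefficients in $\omega_R$, then $J$ annihilates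 $H_s(I,\omega_R)$ and $\delta_{R/J}(H_s(I,\omega_R))=0$. -/

import Mathlib

open CategoryTheory Abelian
open scoped TensorProduct

universe u v

noncomputable section

namespace DeltaInv

/-! ### Depth and Cohen–Macaulay modules over a local ring -/

section CohenMacaulay

variable (R : Type u) [CommRing R] [IsLocalRing R]
variable (M : Type v) [AddCommGroup M] [Module R M]

/-- The depth of `M`: the supremum of the lengths of the `M`-regular sequences
contained in the maximal ideal of `R`. -/
def depth : ℕ∞ :=
  ⨆ rs : {rs : List R // (∀ r ∈ rs, r ∈ IsLocalRing.maximalIdeal R) ∧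
    RingTheory.Sequence.IsRegular M rs}, (rs.1.length : ℕ∞)

/-- `M` is a Cohen–Macaulay module: nonzero, finitely generated, with `depth M = dim M`. -/
structure IsCohenMacaulay : Prop where
  finite : Module.Finite R M
  nontrivial : Nontrivial M
  depth_eq_dim : ((depth R M : ℕ∞) : WithBot ℕ∞) = Module.supportDim R M

/-- `M` is a maximal Cohen–Macaulay module: Cohen–Macaulay with `dim M = dim R`. -/
structure IsMaximalCohenMacaulay : Prop extends IsCohenMacaulay R M where
  dim_eq_dim : Module.supportDim R M = ringKrullDim R

/-- `M` has no nonzero free direct summand. -/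
def HasNoFreeSummand : Prop :=
  ∀ P Q : Submodule R M, IsCompl P Q → Module.Free R P → P = ⊥

/-- `M^cm`: the sum of all submodules `φ(L)` of `M`, where `L` is a maximal Cohen–Macaulay
`R`-module without nonzero free direct summands and `φ : L → M` is `R`-linear.  (As such an `L` is
finitely generated, it is no restriction to take it in the universe of `R`.) -/
def cmPart : Submodule R M :=
  sSup {N | ∃ (L : Type u) (_ : AddCommGroup L) (_ : Module R L),
    IsMaximalCohenMacaulay R L ∧ HasNoFreeSummand R L ∧
      ∃ φ : L →ₗ[R] M, LinearMap.range φ = N}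

/-- The delta invariant `δ_R(M) = μ_R(M / M^cm)`, where `μ_R` is the minimal number of
generators. -/
def delta : ℕ∞ :=
  Cardinal.toENat (Submodule.spanRank (⊤ : Submodule R (M ⧸ cmPart R M)))

end CohenMacaulay

/-- `δ_{R/J}(M)` for an `R`-module `M` with `J M = 0`, regarded as an `R/J`-module. -/
def deltaQuotient {R : Type u} [CommRing R] (J : Ideal R) [IsLocalRing (R ⧸ J)]
    (M : Type v) [AddCommGroup M] [Module R M] (h : Module.IsTorsionBySet R M J) : ℕ∞ :=
  letI := h.module
  delta (R ⧸ J) M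

/-! ### Canonical modules and Gorenstein rings -/

section Canonical

/-- `M` has finite injective dimension. -/
def HasFiniteInjDim (R : Type u) [CommRing R] (M : Type u) [AddCommGroup M] [Module R M] : Prop :=
  ∃ n : ℕ, HasInjectiveDimensionLE (ModuleCat.of R M) n

variable (R : Type u) [CommRing R] [IsLocalRing R]

/-- A Noetherian local ring `R` is Gorenstein if it has finite injective dimension as a module
over itself. -/
def IsGorenstein : Prop := HasFiniteInjDim R R

/-- `M` has type `1`: with `d = depth M` and `k` the residue field, the `k`-vector space
`Ext^d_R(k, M)` is one-dimensional. -/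
def HasTypeOne (M : Type u) [AddCommGroup M] [Module R M] : Prop :=
  ∃ d : ℕ, depth R M = d ∧
    Nonempty (Ext (ModuleCat.of R (IsLocalRing.ResidueField R)) (ModuleCat.of R M) d
      ≃ₗ[R] IsLocalRing.ResidueField R)

/-- A canonical module of `R`: a maximal Cohen–Macaulay module of type `1` and of finite
injective dimension. -/
structure IsCanonicalModule (ω : Type u) [AddCommGroup ω] [Module R ω] : Prop extends
    IsMaximalCohenMacaulay R ω where
  typeOne : HasTypeOne R ω
  finiteInjDim : HasFiniteInjDim R ω

end Canonical

/-! ### The Koszul complex -/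

section Koszul

variable {R : Type u} [CommRing R]

lemma contractLeft_mem_exteriorPower {N : Type v} [AddCommGroup N] [Module R N]
    (f : Module.Dual R N) (p : ℕ) (z : ExteriorAlgebra R N) (hz : z ∈ ⋀[R]^(p + 1) N) :
    CliffordAlgebra.contractLeft (Q := (0 : QuadraticForm R N)) f z ∈ ⋀[R]^p N := by
  induction p generalizing z with
  | zero =>
    have hz' : z ∈ LinearMap.range (ExteriorAlgebra.ι R (M := N)) := by
      simpa [ExteriorAlgebra.exteriorPower] using hz
    obtain ⟨a, rfl⟩ := hz'
    have := CliffordAlgebra.contractLeft_ι (0 : QuadraticForm R N) f a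
    change CliffordAlgebra.contractLeft f (CliffordAlgebra.ι 0 a) ∈ _
    rw [this]
    simp only [ExteriorAlgebra.exteriorPower, pow_zero]
    exact Submodule.mem_one.mpr ⟨_, rfl⟩
  | succ p ih =>
    have hz' : z ∈ LinearMap.range (ExteriorAlgebra.ι R (M := N)) * ⋀[R]^(p + 1) N := by
      simpa [ExteriorAlgebra.exteriorPower, pow_succ'] using hz
    induction hz' using Submodule.mul_induction_on' with
    | mem_mul_mem y hy w hw =>
      obtain ⟨a, rfl⟩ := hy
      have h := CliffordAlgebra.contractLeft_ι_mul (Q := (0 : QuadraticForm R N)) (d := f) a w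
      change CliffordAlgebra.contractLeft f (CliffordAlgebra.ι 0 a * w) ∈ _
      rw [h]
      refine Submodule.sub_mem _ (Submodule.smul_mem _ _ hw) ?_
      have h2 := Submodule.mul_mem_mul (LinearMap.mem_range_self (ExteriorAlgebra.ι R) a)
        (ih w hw)
      simpa [ExteriorAlgebra.exteriorPower, pow_succ'] using h2
    | add y hy w hw h1 h2 =>
      rw [map_add]
      have e : LinearMap.range (ExteriorAlgebra.ι R (M := N)) * ⋀[R]^(p + 1) N
          = ⋀[R]^(p + 1 + 1) N := by
        simp [ExteriorAlgebra.exteriorPower, pow_succ']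
      exact Submodule.add_mem _ (h1 (e ▸ hy)) (h2 (e ▸ hw))

/-- The differential `⋀^{p+1} N → ⋀^p N` of the Koszul complex of a linear form `f : N → R`:
`a₀ ∧ ⋯ ∧ aₚ ↦ ∑ᵢ (-1)ⁱ f(aᵢ) a₀ ∧ ⋯ âᵢ ⋯ ∧ aₚ`, i.e. the contraction with `f`. -/
def koszulD {N : Type v} [AddCommGroup N] [Module R N] (f : Module.Dual R N) (p : ℕ) :
    ⋀[R]^(p + 1) N →ₗ[R] ⋀[R]^p N :=
  (CliffordAlgebra.contractLeft (Q := (0 : QuadraticForm R N)) f).restrict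
    (contractLeft_mem_exteriorPower f p)

lemma koszulD_comp {N : Type v} [AddCommGroup N] [Module R N] (f : Module.Dual R N) (p : ℕ) :
    koszulD f p ∘ₗ koszulD f (p + 1) = 0 := by
  ext1
  apply AlternatingMap.ext
  intro z
  apply Subtype.ext
  exact CliffordAlgebra.contractLeft_contractLeft (Q := (0 : QuadraticForm R N)) (d := f) _

/-- The Koszul complex `K(x; M) = ⋀ Rⁿ ⊗ M` of a sequence `x = x₁, …, xₙ` in `R` with coefficients
in `M`; its differential is induced by the linear form `Rⁿ → R`, `eᵢ ↦ xᵢ`. -/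
def koszulComplex {n : ℕ} (x : Fin n → R) (M : Type u) [AddCommGroup M] [Module R M] :
    ChainComplex (ModuleCat.{u} R) ℕ :=
  ChainComplex.of (fun p => ModuleCat.of R ((⋀[R]^p (Fin n → R)) ⊗[R] M))
    (fun p => ModuleCat.ofHom
      (LinearMap.rTensor M (koszulD (Fintype.linearCombination R x) p)))
    (fun p => by
      rw [← ModuleCat.ofHom_comp, ← LinearMap.rTensor_comp, koszulD_comp, LinearMap.rTensor_zero]
      rfl)

/-- The Koszul homology module `H_p(x; M)`. -/
abbrev koszulHomology {n : ℕ} (x : Fin n → R) (M : Type u) [AddCommGroup M] [Module R M]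
    (p : ℕ) : ModuleCat.{u} R :=
  (koszulComplex x M).homology p

end Koszul

end DeltaInv

end

/-! Let `g = dim R - dim R/I`, which equals `ht I`. Only `Ext^g(R/I, ω)` can be nonzero: Ischebeck's
theorem gives vanishing below `g`, and Bass' bound on the finite injective dimension of `ω`, lowered
by a maximal regular sequence on `R/I`, gives it above. That sequence stays regular on `Ext^g(R/I,
ω)` (`isWeaklyRegular_ext`).

Take `J` generated by an `R`-regular sequence of length `g` in `I`. Then `R/J` is Cohen–Macaulay
with `dim R/J = dim R/I`, so a nonzero `Ext^g(R/I, ω)` is maximal Cohen–Macaulay over `R/J`. It is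
killed by `I`, so if `J ≠ I` it has no free summand over `R/J`; its `cm` part is then everything and
`δ` vanishes.

Squaring the last element of the sequence ensures `J ≠ I` when `g > 0`. When `g = 0`, `J = 0`, and
`J = I` only for `I = 0`. The module is then `ω`, and a free summand would make `R` a retract of
`ω`, hence Gorenstein, which is excluded.

The Koszul statement reduces to this one through `H_{n-g}(x; ω) ≅ Ext^g(R/I, ω)`
(`koszulHomology_equiv_ext`). -/

namespace DeltaInv

/-! ### Vanishing of Ext: the theorems of Ischebeck and Bass -/

section ExtVanishing

variable {R : Type u} [CommRing R]

open Pointwise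

/-- An isomorphism in the first variable induces a linear equivalence on `Ext`. -/
noncomputable def extCongrLeft {X X' : ModuleCat.{u} R} (e : X ≅ X') (Y : ModuleCat.{u} R) (i : ℕ) :
    Ext X' Y i ≃ₗ[R] Ext X Y i :=
  LinearEquiv.ofLinearMap
    (Ext.precompOfLinear (Ext.mk₀ e.hom) R Y (zero_add i))
    (Ext.precompOfLinear (Ext.mk₀ e.inv) R Y (zero_add i))
    (by ext x; simp [Ext.mk₀_comp_mk₀_assoc])
    (by ext x; simp [Ext.mk₀_comp_mk₀_assoc])

lemma subsingleton_ext_congr {N N' : Type u} [AddCommGroup N] [Module R N] [AddCommGroup N']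
    [Module R N'] (e : N ≃ₗ[R] N') (Y : ModuleCat.{u} R) (i : ℕ)
    (h : Subsingleton (Ext (ModuleCat.of R N') Y i)) :
    Subsingleton (Ext (ModuleCat.of R N) Y i) :=
  (extCongrLeft e.toModuleIso Y i).symm.toEquiv.subsingleton

lemma smulShortComplex_f_comp {N Y : ModuleCat.{u} R} (y : R) {i : ℕ} (z : Ext N Y i) :
    (Ext.mk₀ (N.smulShortComplex y).f).comp z (zero_add i) = y • z := by
  change (Ext.mk₀ (y • 𝟙 N)).comp z (zero_add i) = y • z
  rw [Ext.mk₀_smul, Ext.smul_comp, Ext.mk₀_id_comp]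

lemma smul_surjective_of_subsingleton_ext {N : ModuleCat.{u} R} (Y : ModuleCat.{u} R) {y : R}
    (hy : IsSMulRegular N y) (i : ℕ)
    (h : Subsingleton (Ext (ModuleCat.of R (QuotSMulTop y N)) Y (i + 1))) (z : Ext N Y i) :
    ∃ w : Ext N Y i, y • w = z := by
  obtain ⟨w, hw⟩ := Ext.contravariant_sequence_exact₁ hy.smulShortComplex_shortExact Y z
    (add_comm 1 i) (h.elim _ _)
  exact ⟨w, (smulShortComplex_f_comp y w).symm.trans hw⟩

lemma isSMulRegular_ext_of_subsingleton {N : ModuleCat.{u} R} (Y : ModuleCat.{u} R) {y : R}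
    (hy : IsSMulRegular N y) (i : ℕ)
    (h : Subsingleton (Ext (ModuleCat.of R (QuotSMulTop y N)) Y i)) :
    IsSMulRegular (Ext N Y i) y := by
  rw [isSMulRegular_iff_right_eq_zero_of_smul]
  intro z hz
  obtain ⟨w, hw⟩ := Ext.contravariant_sequence_exact₂ hy.smulShortComplex_shortExact Y z
    ((smulShortComplex_f_comp y z).trans hz)
  rw [← hw, show w = 0 from h.elim _ _, Ext.comp_zero]
  rfl

/-- If `y` is `N`-regular and `Ext^{i+1}(N, Y) = 0` then
`Ext^i(N, Y) / y Ext^i(N, Y) ≅ Ext^{i+1}(N / y N, Y)`. -/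
lemma nonempty_quotSMulTop_ext_equiv {N : ModuleCat.{u} R} (Y : ModuleCat.{u} R) {y : R}
    (hy : IsSMulRegular N y) (i : ℕ) (h : Subsingleton (Ext N Y (i + 1))) :
    Nonempty (QuotSMulTop y (Ext N Y i) ≃ₗ[R]
      Ext (ModuleCat.of R (QuotSMulTop y N)) Y (i + 1)) := by
  have hS := hy.smulShortComplex_shortExact
  let δ : Ext N Y i →ₗ[R] Ext (ModuleCat.of R (QuotSMulTop y N)) Y (i + 1) :=
    Ext.precompOfLinear hS.extClass R Y (add_comm 1 i)
  have hsurj : Function.Surjective δ := fun x ↦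
    Ext.contravariant_sequence_exact₃ hS Y x (h.elim _ _) (add_comm 1 i)
  have hker : y • (⊤ : Submodule R (Ext N Y i)) = LinearMap.ker δ := by
    ext z
    rw [Submodule.mem_smul_pointwise_iff_exists, LinearMap.mem_ker]
    constructor
    · rintro ⟨w, -, rfl⟩
      rw [← smulShortComplex_f_comp]
      exact ShortComplex.ShortExact.extClass_comp_assoc hS w (h := add_comm 1 i)
    · intro hz
      obtain ⟨w, hw⟩ := Ext.contravariant_sequence_exact₁ hS Y z (add_comm 1 i) hz
      exact ⟨w, trivial, (smulShortComplex_f_comp y w).symm.trans hw⟩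
  exact ⟨(Submodule.quotEquivOfEq _ _ hker).trans (δ.quotKerEquivOfSurjective hsurj)⟩

lemma subsingleton_ext_middle {N₁ N₂ N₃ : Type u} [AddCommGroup N₁] [Module R N₁]
    [AddCommGroup N₂] [Module R N₂] [AddCommGroup N₃] [Module R N₃]
    (f : N₁ →ₗ[R] N₂) (g : N₂ →ₗ[R] N₃) (hf : Function.Injective f) (hg : Function.Surjective g)
    (hfg : Function.Exact f g) (Y : ModuleCat.{u} R) (i : ℕ)
    (h₁ : Subsingleton (Ext (ModuleCat.of R N₁) Y i))
    (h₃ : Subsingleton (Ext (ModuleCat.of R N₃) Y i)) :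
    Subsingleton (Ext (ModuleCat.of R N₂) Y i) := by
  have hS := ModuleCat.shortComplex_shortExact
    (ModuleCat.shortComplexOfCompEqZero f g hfg.linearMap_comp_eq_zero) hfg hf hg
  refine subsingleton_of_forall_eq 0 fun z ↦ ?_
  obtain ⟨w, hw⟩ := Ext.contravariant_sequence_exact₂ hS Y z (h₁.elim _ _)
  rw [← hw, show w = 0 from h₃.elim _ _, Ext.comp_zero]

/-- If `Ext^{i+1}(C, Y) = 0` for all finite `C`, then `Ext^i(-, Y)` turns injections of finite
modules into surjections. -/
lemma subsingleton_ext_of_injective {N₁ N₂ : Type u} [AddCommGroup N₁] [Module R N₁]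
    [AddCommGroup N₂] [Module R N₂] [Module.Finite R N₂]
    (f : N₁ →ₗ[R] N₂) (hf : Function.Injective f) (Y : ModuleCat.{u} R) (i : ℕ)
    (h : ∀ C : ModuleCat.{u} R, Module.Finite R C → Subsingleton (Ext C Y (i + 1)))
    (h₂ : Subsingleton (Ext (ModuleCat.of R N₂) Y i)) :
    Subsingleton (Ext (ModuleCat.of R N₁) Y i) := by
  have hfg : Function.Exact f (LinearMap.range f).mkQ := LinearMap.exact_map_mkQ_range f
  have hS := ModuleCat.shortComplex_shortExact
    (ModuleCat.shortComplexOfCompEqZero f _ hfg.linearMap_comp_eq_zero) hfg hf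
      (Submodule.mkQ_surjective _)
  refine subsingleton_of_forall_eq 0 fun z ↦ ?_
  obtain ⟨w, hw⟩ := Ext.contravariant_sequence_exact₁ hS Y z (add_comm 1 i)
    ((h (ModuleCat.of R (N₂ ⧸ LinearMap.range f)) inferInstance).elim _ _)
  rw [← hw, show w = 0 from h₂.elim _ _, Ext.comp_zero]

variable [IsLocalRing R] [IsNoetherianRing R]

open IsLocalRing

/-- Nakayama: the hypothesis makes multiplication by `y` surjective on the finite module `Ext^i(N,
Y)`. This is the device for passing from `N / yN` back to `N`, at the cost of one degree. -/
lemma subsingleton_ext_of_quotSMulTop {N Y : ModuleCat.{u} R} [Module.Finite R N]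
    [Module.Finite R Y] {y : R} (hy : IsSMulRegular N y) (hm : y ∈ maximalIdeal R) (i : ℕ)
    (h : Subsingleton (Ext (ModuleCat.of R (QuotSMulTop y N)) Y (i + 1))) :
    Subsingleton (Ext N Y i) := by
  by_contra! hn
  refine Submodule.top_ne_pointwise_smul_of_mem_jacobson_annihilator
    (R := R) (M := Ext N Y i) (maximalIdeal_le_jacobson _ hm) ?_
  rw [eq_comm, eq_top_iff]
  intro z _
  obtain ⟨w, rfl⟩ := smul_surjective_of_subsingleton_ext Y hy i h z
  exact Submodule.smul_mem_pointwise_smul _ _ ⊤ trivial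

omit [IsLocalRing R] [IsNoetherianRing R] in
lemma isSMulRegular_quotient_prime {N : Type u} [AddCommGroup N] [Module R N]
    (p : PrimeSpectrum R) (e : N ≃ₗ[R] R ⧸ p.1) {y : R} (hy : y ∉ p.1) : IsSMulRegular N y := by
  rw [e.isSMulRegular_congr, isSMulRegular_quotient_iff_mem_of_smul_mem]
  intro x hx
  exact (p.2.mem_or_mem hx).resolve_left hy

/-- **Ischebeck's theorem**: `Ext^i(N, M) = 0` for `i < depth M - dim N`. -/
theorem subsingleton_ext_of_supportDim_lt {M : ModuleCat.{u} R} [Module.Finite R M] {n : ℕ}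
    (hM : ∀ i < n, Subsingleton (Ext (ModuleCat.of R (ResidueField R)) M i)) (r : ℕ)
    (N : Type u) [AddCommGroup N] [Module R N] (hN : Module.Finite R N)
    (hr : Module.supportDim R N < r) (i : ℕ) (hi : i + r ≤ n) :
    Subsingleton (Ext (ModuleCat.of R N) M i) := by
  -- `r` strictly bounds the dimension, so `r = 0` means `N = 0`. Otherwise a prime filtration
  -- reduces to `R/p`: for `p ≠ m`, dividing by some `y ∈ m \ p` trades one unit of `r` for one of
  -- `i`, keeping `i + r`.
  induction r generalizing N i with
  | zero =>
    have : Subsingleton N := by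
      by_contra! hn
      obtain ⟨p, hp⟩ := Module.nonempty_support_of_nontrivial (R := R) (M := N)
      have : Nonempty (Module.support R N) := ⟨⟨p, hp⟩⟩
      exact (not_lt_of_ge (Order.krullDim_nonneg (α := Module.support R N))) hr
    have := (ModuleCat.isZero_of_subsingleton (ModuleCat.of R N))
    refine subsingleton_of_forall_eq 0 fun z ↦ ?_
    rw [← Ext.mk₀_id_comp z, this.eq_zero_of_src (𝟙 _)]
    simp
  | succ r ih =>
    induction hN using IsNoetherianRing.induction_on_isQuotientEquivQuotientPrime R generalizing i
      with
    | subsingleton N =>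
      refine ih N inferInstance ?_ i (by omega)
      rw [Module.supportDim_eq_bot_of_subsingleton]
      exact WithBot.bot_lt_coe _
    | quotient N p e =>
      by_cases hp : p.1 = maximalIdeal R
      · refine subsingleton_ext_congr (e.trans (Submodule.quotEquivOfEq _ _ hp)) M i
          (hM i (by omega))
      · obtain ⟨y, hy, hyp⟩ := SetLike.exists_of_lt
          (lt_of_le_of_ne (le_maximalIdeal p.2.ne_top) hp)
        have hreg := isSMulRegular_quotient_prime p e hyp
        refine subsingleton_ext_of_quotSMulTop (N := ModuleCat.of R N) hreg hy i
          (ih _ inferInstance ?_ (i + 1) (by omega))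
        have := Module.supportDim_quotSMulTop_succ_eq_supportDim (M := N) hreg hy
        rw [← this] at hr
        push_cast at hr
        exact lt_of_add_lt_add_right hr
    | exact N₁ N₂ N₃ f g hf hg hfg h₁ h₃ =>
      exact subsingleton_ext_middle f g hf hg hfg M i
        (h₁ ((Module.supportDim_le_of_injective f hf).trans_lt hr) i hi)
        (h₃ ((Module.supportDim_le_of_surjective g hg).trans_lt hr) i hi)

/-- If `Ext^i(k, Y) = 0` and `Ext^{i+1}(C, Y) = 0` for all finite `C`, then `Ext^i(N, Y) = 0` for all
finite `N`. -/
lemma subsingleton_ext_of_residueField {Y : ModuleCat.{u} R} [Module.Finite R Y] (i : ℕ)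
    (h : ∀ C : ModuleCat.{u} R, Module.Finite R C → Subsingleton (Ext C Y (i + 1)))
    (hk : Subsingleton (Ext (ModuleCat.of R (ResidueField R)) Y i))
    (N : Type u) [AddCommGroup N] [Module R N] (hN : Module.Finite R N) :
    Subsingleton (Ext (ModuleCat.of R N) Y i) := by
  induction hN using IsNoetherianRing.induction_on_isQuotientEquivQuotientPrime R with
  | subsingleton N =>
    have := (ModuleCat.isZero_of_subsingleton (ModuleCat.of R N))
    refine subsingleton_of_forall_eq 0 fun z ↦ ?_
    rw [← Ext.mk₀_id_comp z, this.eq_zero_of_src (𝟙 _)]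
    simp
  | quotient N p e =>
    by_cases hp : p.1 = maximalIdeal R
    · exact subsingleton_ext_congr (e.trans (Submodule.quotEquivOfEq _ _ hp)) Y i hk
    · obtain ⟨y, hy, hyp⟩ := SetLike.exists_of_lt
        (lt_of_le_of_ne (le_maximalIdeal p.2.ne_top) hp)
      exact subsingleton_ext_of_quotSMulTop (N := ModuleCat.of R N)
        (isSMulRegular_quotient_prime p e hyp) hy i
        (h (ModuleCat.of R (QuotSMulTop y N)) inferInstance)
  | exact N₁ N₂ N₃ f g hf hg hfg h₁ h₃ => exact subsingleton_ext_middle f g hf hg hfg Y i h₁ h₃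

/-- A finite module of dimension zero contains a copy of the residue field. -/
lemma exists_injective_residueField {N : Type u} [AddCommGroup N] [Module R N]
    [Module.Finite R N] (hN : Module.supportDim R N = 0) :
    ∃ f : ResidueField R →ₗ[R] N, Function.Injective f := by
  have hnt : Nontrivial N := by simp [← Module.supportDim_ne_bot_iff_nontrivial R, hN]
  -- In dimension zero the support is `{m}`, so any associated prime is `m`.
  obtain ⟨p, hp⟩ := associatedPrimes.nonempty R N
  have hps : (⟨p, hp.isPrime⟩ : PrimeSpectrum R) ∈ Module.support R N :=
    Module.mem_support_iff_of_finite.mpr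
      (Submodule.annihilator_top (R := R) (M := N) ▸ hp.annihilator_le)
  rw [_root_.support_of_supportDim_eq_zero R N hN] at hps
  obtain rfl : p = maximalIdeal R := (le_maximalIdeal hp.isPrime.ne_top).antisymm hps
  obtain ⟨-, x, hx⟩ := isAssociatedPrime_iff.mp hp
  have hx' : maximalIdeal R = LinearMap.ker (LinearMap.toSpanSingleton R N x) := by
    rw [hx]; ext; simp
  exact ⟨Submodule.liftQ _ (LinearMap.toSpanSingleton R N x) hx'.le,
    LinearMap.ker_eq_bot.mp (Submodule.ker_liftQ_eq_bot _ _ _ hx'.ge)⟩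

/-- **Bass' theorem**: if `R` has a regular sequence of length `dim R` and `Y` has finite injective
dimension, then `Ext^i(N, Y) = 0` for `i > dim R` and `N` finite. -/
theorem subsingleton_ext_of_lt_of_hasInjectiveDimension {Y : ModuleCat.{u} R} [Module.Finite R Y]
    {n : ℕ} (hn : HasInjectiveDimensionLE Y n) {rs : List R}
    (hrs : RingTheory.Sequence.IsRegular R rs) (hmem : ∀ r ∈ rs, r ∈ maximalIdeal R)
    (hdim : ringKrullDim R = rs.length) (i : ℕ) (hi : rs.length < i)
    (N : ModuleCat.{u} R) (hN : Module.Finite R N) : Subsingleton (Ext N Y i) := by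
  -- Descending induction on `i`; `k` bounds the distance to the degrees `> n`, where the injective
  -- dimension decides.
  obtain ⟨k, hk⟩ : ∃ k, n + 1 ≤ i + k := ⟨n + 1, by omega⟩
  induction k generalizing i N with
  | zero => exact HasInjectiveDimensionLT.subsingleton Y (n + 1) i hk N
  | succ k ih =>
    have h (C : ModuleCat.{u} R) (hC : Module.Finite R C) : Subsingleton (Ext C Y (i + 1)) :=
      ih (i + 1) (by omega) C hC (by omega)
    -- `Q` has projective dimension at most `rs.length < i`, so `Ext^i(Q, Y) = 0`; being of
    -- dimension zero it contains the residue field, and the vanishing in degree `i + 1` passes from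
    -- `Q` to this submodule.
    let Q := R ⧸ (Ideal.ofList rs • (⊤ : Submodule R R))
    have hpd : projectiveDimension (ModuleCat.of R Q) ≤ rs.length := by
      have := ModuleCat.projectiveDimension_quotient_eq_add_length_of_isWeaklyRegular
        (ModuleCat.of R R) rs hrs.1 hmem
      have h0 := ModuleCat.projectiveDimension_eq_zero_of_projective (ModuleCat.of R R)
      exact (this.trans (by rw [h0, zero_add])).le
    have hQdim : Module.supportDim R Q = 0 := by
      have := Module.supportDim_add_length_eq_supportDim_of_isRegular rs hrs
      rw [Module.supportDim_self_eq_ringKrullDim, hdim] at this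
      exact ENat.WithBot.add_natCast_cancel.mp (this.trans (zero_add _).symm)
    obtain ⟨f, hf⟩ := exists_injective_residueField hQdim
    have hpd' := (projectiveDimension_le_iff _ _).mp hpd
    exact subsingleton_ext_of_residueField i h (subsingleton_ext_of_injective f hf Y i h
      (HasProjectiveDimensionLT.subsingleton _ (rs.length + 1) i hi Y)) N hN

/-- If `rs` is `N`-regular and `Ext^i(C, Y) = 0` for `i > d` and all finite `C`, then
`Ext^i(N, Y) = 0` for `i > d - length rs`. -/
theorem subsingleton_ext_of_isWeaklyRegular {Y : ModuleCat.{u} R} [Module.Finite R Y] {d : ℕ}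
    (h : ∀ i, d < i → ∀ C : ModuleCat.{u} R, Module.Finite R C → Subsingleton (Ext C Y i))
    (rs : List R) (hmem : ∀ r ∈ rs, r ∈ maximalIdeal R) (N : Type u) [AddCommGroup N] [Module R N]
    [Module.Finite R N] (hrs : RingTheory.Sequence.IsWeaklyRegular N rs) (i : ℕ)
    (hi : d < i + rs.length) : Subsingleton (Ext (ModuleCat.of R N) Y i) := by
  induction rs generalizing N i with
  | nil => exact h i hi _ inferInstance
  | cons y rs ih =>
    rw [RingTheory.Sequence.isWeaklyRegular_cons_iff] at hrs
    rw [List.length_cons] at hi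
    exact subsingleton_ext_of_quotSMulTop (N := ModuleCat.of R N) hrs.1 (hmem y (by simp)) i
      (ih (fun r hr ↦ hmem r (by simp [hr])) _ hrs.2 (i + 1) (by omega))

/-- A regular sequence on a Cohen–Macaulay module `N` of codimension `g` is regular on
`Ext^g(N, Y)`. -/
theorem isWeaklyRegular_ext {Y : ModuleCat.{u} R} [Module.Finite R Y] {d : ℕ}
    (h : ∀ i, d < i → ∀ C : ModuleCat.{u} R, Module.Finite R C → Subsingleton (Ext C Y i))
    (hY : ∀ i < d, Subsingleton (Ext (ModuleCat.of R (ResidueField R)) Y i))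
    (rs : List R) (hmem : ∀ r ∈ rs, r ∈ maximalIdeal R) (N : Type u) [AddCommGroup N] [Module R N]
    [Module.Finite R N] (hrs : RingTheory.Sequence.IsWeaklyRegular N rs) (g : ℕ)
    (hdim : Module.supportDim R N = rs.length) (hg : g + rs.length = d) :
    RingTheory.Sequence.IsWeaklyRegular (Ext (ModuleCat.of R N) Y g) rs := by
  induction rs generalizing N g with
  | nil => simp
  | cons y rs ih =>
    have hrs' := hrs
    rw [RingTheory.Sequence.isWeaklyRegular_cons_iff] at hrs ⊢
    have hy := hmem y (by simp)
    have hdim' : Module.supportDim R (QuotSMulTop y N) = rs.length := by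
      have := Module.supportDim_quotSMulTop_succ_eq_supportDim (M := N) hrs.1 hy
      rw [hdim, List.length_cons, Nat.cast_add] at this
      exact ENat.WithBot.add_natCast_cancel.mp this
    rw [List.length_cons] at hg
    -- `y` is regular because `Ext^g(N/yN, Y) = 0` by Ischebeck. Since `Ext^{g+1}(N, Y) = 0`, the
    -- quotient by `y` is `Ext^{g+1}(N/yN, Y)`, to which induction applies.
    refine ⟨isSMulRegular_ext_of_subsingleton (N := ModuleCat.of R N) Y hrs.1 g
      (subsingleton_ext_of_supportDim_lt hY (rs.length + 1) _ inferInstance ?_ g (by omega)), ?_⟩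
    · rw [hdim']
      exact_mod_cast Nat.lt_succ_self _
    · obtain ⟨e⟩ := nonempty_quotSMulTop_ext_equiv (N := ModuleCat.of R N) Y hrs.1 g
        (subsingleton_ext_of_isWeaklyRegular h (y :: rs) hmem N hrs' (g + 1)
          (by rw [List.length_cons]; omega))
      rw [e.isWeaklyRegular_congr]
      exact ih (fun r hr ↦ hmem r (by simp [hr])) _ hrs.2 (g + 1) hdim' (by omega)

end ExtVanishing

/-! ### Depth, regular sequences and height in Cohen–Macaulay rings -/

section Depth

open IsLocalRing RingTheory.Sequence

variable {R : Type u} [CommRing R] [IsLocalRing R] [IsNoetherianRing R]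

section Module

variable (M : Type u) [AddCommGroup M] [Module R M] [Module.Finite R M]

omit [IsNoetherianRing R] in
lemma ideal_smul_top_lt_top [Nontrivial M] {I : Ideal R} (hI : I ≤ maximalIdeal R) :
    I • (⊤ : Submodule R M) < ⊤ :=
  (Submodule.top_ne_ideal_smul_of_le_jacobson_annihilator
    (hI.trans (maximalIdeal_le_jacobson _))).symm.lt_top

lemma subsingleton_ext_residueField_of_isRegular {rs : List R} (hrs : IsRegular M rs)
    (hmem : ∀ r ∈ rs, r ∈ maximalIdeal R) (i : ℕ) (hi : i < rs.length) :
    Subsingleton (Ext (ModuleCat.of R (ResidueField R)) (ModuleCat.of R M) i) := by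
  have := hrs.nontrivial
  refine ModuleCat.subsingleton_ext_of_exists_isRegular (maximalIdeal R) _ ?_ _
    (ideal_smul_top_lt_top M le_rfl) rs hmem hrs i hi
  have h : Module.support R (R ⧸ maximalIdeal R) =
      PrimeSpectrum.zeroLocus (maximalIdeal R : Set R) := by
    rw [Module.support_eq_zeroLocus, Ideal.annihilator_quotient]
  exact h.subset

/-- Rees' criterion. Applied to `m` it realizes the depth; applied to a smaller `I` it turns
Ischebeck's vanishing into a regular sequence inside `I`. -/
lemma exists_isRegular_of_subsingleton_ext [Nontrivial M] {I : Ideal R} (hI : I ≠ ⊤) (n : ℕ)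
    (h : ∀ i < n, Subsingleton (Ext (ModuleCat.of R (R ⧸ I)) (ModuleCat.of R M) i)) :
    ∃ rs : List R, rs.length = n ∧ (∀ r ∈ rs, r ∈ I) ∧ IsRegular M rs := by
  refine ModuleCat.exists_isRegular_of_exists_subsingleton_ext I n (ModuleCat.of R M)
    (ideal_smul_top_lt_top M (le_maximalIdeal hI)) (ModuleCat.of R (R ⧸ I)) ?_ h
  change Module.support R (R ⧸ I) = _
  rw [Module.support_eq_zeroLocus, Ideal.annihilator_quotient]

lemma subsingleton_ext_residueField_of_le_depth {n : ℕ} (hn : (n : ℕ∞) ≤ depth R M) (i : ℕ)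
    (hi : i < n) :
    Subsingleton (Ext (ModuleCat.of R (ResidueField R)) (ModuleCat.of R M) i) := by
  have hlt : (i : ℕ∞) < depth R M := lt_of_lt_of_le (by exact_mod_cast hi) hn
  -- The supremum defining the depth need not be known to be attained: one sequence longer than `i`
  -- suffices.
  obtain ⟨⟨rs, hmem, hrs⟩, hlen⟩ := lt_iSup_iff.mp hlt
  exact subsingleton_ext_residueField_of_isRegular M hrs hmem i (by exact_mod_cast hlen)

omit [IsNoetherianRing R] [Module.Finite R M] in
lemma length_le_depth {rs : List R} (hrs : IsRegular M rs)
    (hmem : ∀ r ∈ rs, r ∈ maximalIdeal R) : (rs.length : ℕ∞) ≤ depth R M :=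
  le_iSup (fun rs : {rs : List R // (∀ r ∈ rs, r ∈ maximalIdeal R) ∧ IsRegular M rs} ↦
    (rs.1.length : ℕ∞)) ⟨rs, hmem, hrs⟩

lemma length_le_supportDim {rs : List R} (hrs : IsRegular M rs) :
    (rs.length : WithBot ℕ∞) ≤ Module.supportDim R M := by
  rw [← Module.supportDim_add_length_eq_supportDim_of_isRegular rs hrs]
  have := hrs.quot_ofList_smul_nontrivial ⊤
  obtain ⟨p, hp⟩ := Module.nonempty_support_of_nontrivial (R := R)
    (M := M ⧸ Ideal.ofList rs • (⊤ : Submodule R M))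
  have : Nonempty (Module.support R (M ⧸ Ideal.ofList rs • (⊤ : Submodule R M))) := ⟨⟨p, hp⟩⟩
  exact le_add_of_nonneg_left Order.krullDim_nonneg

lemma depth_le_supportDim [Nontrivial M] :
    ((depth R M : ℕ∞) : WithBot ℕ∞) ≤ Module.supportDim R M := by
  obtain ⟨s, hs⟩ := WithBot.ne_bot_iff_exists.mp (Module.supportDim_ne_bot_of_nontrivial R M)
  rw [← hs, WithBot.coe_le_coe]
  refine iSup_le fun rs ↦ ?_
  have := length_le_supportDim M rs.2.2
  rw [← hs] at this
  exact_mod_cast this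

variable {M} in
lemma isCohenMacaulay_of_isRegular {rs : List R} (hrs : IsRegular M rs)
    (hmem : ∀ r ∈ rs, r ∈ maximalIdeal R) (hdim : Module.supportDim R M ≤ rs.length) :
    IsCohenMacaulay R M := by
  have := hrs.nontrivial
  refine ⟨inferInstance, this, (depth_le_supportDim M).antisymm (hdim.trans ?_)⟩
  exact_mod_cast length_le_depth M hrs hmem

omit [Module.Finite R M] in
lemma exists_supportDim_eq_natCast [Nontrivial M] : ∃ n : ℕ, Module.supportDim R M = n := by
  obtain ⟨s, hs⟩ := WithBot.ne_bot_iff_exists.mp (Module.supportDim_ne_bot_of_nontrivial R M)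
  have hlt : Module.supportDim R M < ⊤ :=
    (Module.supportDim_le_ringKrullDim R M).trans_lt ringKrullDim_lt_top
  rw [← hs] at hlt
  obtain ⟨n, rfl⟩ := ENat.ne_top_iff_exists.mp (by rintro rfl; exact hlt.ne rfl : s ≠ ⊤)
  exact ⟨n, hs.symm⟩

end Module

section

variable {M : Type u} [AddCommGroup M] [Module R M]

lemma IsCohenMacaulay.subsingleton_ext_residueField (h : IsCohenMacaulay R M) {n : ℕ}
    (hn : Module.supportDim R M = n) (i : ℕ) (hi : i < n) :
    Subsingleton (Ext (ModuleCat.of R (ResidueField R)) (ModuleCat.of R M) i) := by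
  have := h.finite
  refine subsingleton_ext_residueField_of_le_depth M ?_ i hi
  have := h.depth_eq_dim.trans hn
  exact_mod_cast this.ge

lemma IsCohenMacaulay.exists_isRegular (h : IsCohenMacaulay R M) {n : ℕ}
    (hn : Module.supportDim R M = n) :
    ∃ rs : List R, rs.length = n ∧ (∀ r ∈ rs, r ∈ maximalIdeal R) ∧ IsRegular M rs := by
  have := h.finite
  have := h.nontrivial
  exact exists_isRegular_of_subsingleton_ext M (maximalIdeal.isMaximal R).ne_top n
    (h.subsingleton_ext_residueField hn)

/-- A Cohen–Macaulay module of dimension `d` admits a regular sequence of length `d - dim R/I`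
inside `I`. -/
lemma IsCohenMacaulay.exists_isRegular_mem (h : IsCohenMacaulay R M) {d e g : ℕ}
    (hd : Module.supportDim R M = d) {I : Ideal R} (hI : I ≠ ⊤) (he : ringKrullDim (R ⧸ I) = e)
    (hg : g + e = d) :
    ∃ rs : List R, rs.length = g ∧ (∀ r ∈ rs, r ∈ I) ∧ IsRegular M rs := by
  have := h.finite
  have := h.nontrivial
  refine exists_isRegular_of_subsingleton_ext M hI g fun i hi ↦
    subsingleton_ext_of_supportDim_lt (h.subsingleton_ext_residueField hd) (e + 1) _ inferInstance
      ?_ i (by omega)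
  rw [Module.supportDim_quotient_eq_ringKrullDim, he]
  exact_mod_cast Nat.lt_succ_self e

end

omit [IsNoetherianRing R] in
/-- Dividing by a regular sequence lowers the depth by at most its length. -/
lemma subsingleton_ext_residueField_quotient (rs : List R) (n : ℕ) (M : Type u) [AddCommGroup M]
    [Module R M] (hrs : IsWeaklyRegular M rs)
    (h : ∀ i < n + rs.length,
      Subsingleton (Ext (ModuleCat.of R (ResidueField R)) (ModuleCat.of R M) i)) (i : ℕ)
    (hi : i < n) :
    Subsingleton (Ext (ModuleCat.of R (ResidueField R))
      (ModuleCat.of R (M ⧸ Ideal.ofList rs • (⊤ : Submodule R M))) i) := by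
  have key {N N' : Type u} [AddCommGroup N] [Module R N] [AddCommGroup N'] [Module R N']
      (e : N ≃ₗ[R] N') {j : ℕ}
      (hN : Subsingleton (Ext (ModuleCat.of R (ResidueField R)) (ModuleCat.of R N) j)) :
      Subsingleton (Ext (ModuleCat.of R (ResidueField R)) (ModuleCat.of R N') j) := by
    refine subsingleton_of_forall_eq 0 fun z ↦ ?_
    rw [← Ext.comp_mk₀_id z, ← e.toModuleIso.inv_hom_id, ← Ext.mk₀_comp_mk₀,
      ← Ext.comp_assoc_of_second_deg_zero,
      show z.comp (Ext.mk₀ e.toModuleIso.inv) (add_zero j) = 0 from hN.elim _ _, Ext.zero_comp]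
  induction rs generalizing M with
  | nil =>
    exact key (Submodule.quotEquivOfEqBot _ (by simp)).symm (h i (by simpa using hi))
  | cons y rs ih =>
    rw [isWeaklyRegular_cons_iff] at hrs
    refine key (Submodule.quotOfListConsSMulTopEquivQuotSMulTopInner M y rs).symm
      (ih _ hrs.2 fun j hj ↦ ?_)
    rw [List.length_cons] at h
    -- `Ext^j(k, M/yM)` sits between `Ext^j(k, M)` and `Ext^{j+1}(k, M)`.
    refine subsingleton_of_forall_eq 0 fun z ↦ ?_
    obtain ⟨w, hw⟩ := Ext.covariant_sequence_exact₃ _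
      (IsSMulRegular.smulShortComplex_shortExact (M := ModuleCat.of R M) hrs.1) z rfl
      ((h (j + 1) (by omega)).elim _ _)
    rw [← hw, show w = 0 from (h j (by omega)).elim _ _, Ext.zero_comp]
    rfl

variable (hR : IsCohenMacaulay R R)

include hR in
/-- The quotient of a Cohen–Macaulay local ring by a regular sequence is Cohen–Macaulay. -/
lemma isCohenMacaulay_quotient_ofList {rs : List R} (hrs : IsRegular R rs) {d e : ℕ}
    (hd : ringKrullDim R = d) (he : e + rs.length = d) :
    ringKrullDim (R ⧸ Ideal.ofList rs) = e ∧ IsCohenMacaulay R (R ⧸ Ideal.ofList rs) := by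
  have hdim : ringKrullDim (R ⧸ Ideal.ofList rs) = e := by
    have := ringKrullDim_add_length_eq_ringKrullDim_of_isRegular rs hrs
    rw [hd, ← he, Nat.cast_add] at this
    exact ENat.WithBot.add_natCast_cancel.mp this
  refine ⟨hdim, ?_⟩
  have hd' : Module.supportDim R R = d := by rw [Module.supportDim_self_eq_ringKrullDim, hd]
  have hext := subsingleton_ext_residueField_quotient rs e R hrs.1
    (fun i hi ↦ hR.subsingleton_ext_residueField hd' i (by omega))
  have htop : Ideal.ofList rs • (⊤ : Submodule R R) = Ideal.ofList rs := by simp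
  have hne : Ideal.ofList rs ≠ ⊤ := by
    rw [← htop]; exact hrs.top_ne_smul.symm
  rw [htop] at hext
  have : Nontrivial (R ⧸ Ideal.ofList rs) := Ideal.Quotient.nontrivial_iff.mpr hne
  obtain ⟨ys, hlen, hmem, hys⟩ := exists_isRegular_of_subsingleton_ext (R ⧸ Ideal.ofList rs)
    (maximalIdeal.isMaximal R).ne_top e hext
  refine isCohenMacaulay_of_isRegular hys hmem ?_
  rw [Module.supportDim_quotient_eq_ringKrullDim, hdim, hlen]

include hR in
/-- In a Cohen–Macaulay local ring, every proper ideal of codimension `g` contains an ideal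
generated by a regular sequence of length `g` which is smaller unless `g = 0`. -/
lemma exists_isCohenMacaulay_quotient_le {I : Ideal R} (hI : I ≠ ⊤) {d e g : ℕ}
    (hd : ringKrullDim R = d) (he : ringKrullDim (R ⧸ I) = e) (hg : g + e = d) :
    ∃ J ≤ I, IsCohenMacaulay R (R ⧸ J) ∧ ringKrullDim (R ⧸ J) = e ∧ (J = I → I = ⊥) := by
  have hd' : Module.supportDim R R = d := by rw [Module.supportDim_self_eq_ringKrullDim, hd]
  obtain ⟨rs, hlen, hmem, hrs⟩ := hR.exists_isRegular_mem hd' hI he hg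
  have hIm := le_maximalIdeal hI
  obtain rfl | ⟨rs, y, rfl⟩ := rs.eq_nil_or_concat
  · have := isCohenMacaulay_quotient_ofList hR hrs (e := e) hd (by rw [hlen]; omega)
    refine ⟨Ideal.ofList [], by simp, this.2, this.1, fun h ↦ by rw [← h]; simp⟩
  · rw [List.concat_eq_append] at hlen hmem hrs
    have hrs' := (isWeaklyRegular_append_iff R rs [y]).mp hrs.1
    rw [isWeaklyRegular_singleton_iff] at hrs'
    have hy : y ∈ I := hmem y (by simp)
    -- Squaring the last element keeps the sequence regular but pushes `y` out of the ideal.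
    have hmem' : ∀ r ∈ rs ++ [y ^ 2], r ∈ I := by
      intro r hr
      rcases List.mem_append.mp hr with hr | hr
      · exact hmem r (by simp [hr])
      · rw [List.mem_singleton.mp hr]
        exact I.pow_mem_of_mem hy 2 two_pos
    have hreg : IsRegular R (rs ++ [y ^ 2]) := by
      refine RingTheory.Sequence.IsRegular.of_isWeaklyRegular_of_mem_maximalIdeal R
        (fun r hr ↦ hIm (hmem' r hr)) ((isWeaklyRegular_append_iff R rs [y ^ 2]).mpr
          ⟨hrs'.1, (isWeaklyRegular_singleton_iff _ _).mpr (hrs'.2.pow 2)⟩)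
    have := isCohenMacaulay_quotient_ofList hR hreg (e := e) hd
      (by rw [← hg, ← hlen]; simp [add_comm])
    refine ⟨Ideal.ofList (rs ++ [y ^ 2]), Ideal.span_le.mpr hmem', this.2, this.1, fun h ↦ ?_⟩
    exfalso
    -- If `y = a + c y²` with `a ∈ (rs)`, then `1 - c y` is a unit, so `y ∈ (rs)`; regularity of `y`
    -- modulo `(rs)` gives `1 ∈ (rs) ⊆ I`.
    have hy' := hy
    rw [← h, Ideal.ofList_append, Ideal.ofList_singleton, Submodule.mem_sup] at hy'
    obtain ⟨a, ha, b, hb, hab⟩ := hy'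
    obtain ⟨c, rfl⟩ := Ideal.mem_span_singleton'.mp hb
    have hu : IsUnit (1 - c * y) := by
      by_contra hn
      have h1 : c * y ∈ maximalIdeal R := Ideal.mul_mem_left _ _ (hIm hy)
      exact (maximalIdeal.isMaximal R).ne_top ((Ideal.eq_top_iff_one _).mpr
        (by simpa using add_mem ((mem_maximalIdeal _).mpr hn) h1))
    have hmul : (1 - c * y) * y ∈ Ideal.ofList rs := by
      convert ha using 1
      linear_combination -hab
    have hyrs : y ∈ Ideal.ofList rs := (Ideal.unit_mul_mem_iff_mem _ hu).mp hmul
    have htop : Ideal.ofList rs • (⊤ : Submodule R R) = Ideal.ofList rs := by simp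
    have h1 := mem_of_isSMulRegular_quotient_of_smul_mem hrs'.2 (x := (1 : R))
      (by rw [htop]; simpa using hyrs)
    rw [htop] at h1
    refine hI ((Ideal.eq_top_iff_one _).mpr ?_)
    exact Ideal.span_le.mpr (fun r hr ↦ hmem r (by simp [show r ∈ rs from hr])) h1

omit [IsLocalRing R] in
/-- The height of an ideal is at least the length of a regular sequence in it. -/
lemma length_le_height_of_isWeaklyRegular {rs : List R} (hrs : IsWeaklyRegular R rs)
    {I : Ideal R} (hmem : ∀ r ∈ rs, r ∈ I) : (rs.length : ℕ∞) ≤ I.height := by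
  rw [Ideal.height_eq_inf_minimalPrimes]
  refine le_iInf₂ fun p hp ↦ ?_
  have := hp.1.1
  have hreg := hrs.isRegular_of_isLocalization_of_mem (Localization.AtPrime p) p
    (fun r hr ↦ hp.1.2 (hmem r hr))
  have hlen := length_le_supportDim (Localization.AtPrime p) hreg
  rw [Module.supportDim_self_eq_ringKrullDim,
    IsLocalization.AtPrime.ringKrullDim_eq_height p, List.length_map] at hlen
  exact_mod_cast hlen

omit [IsLocalRing R] [IsNoetherianRing R] in
-- A chain of length `e` of primes over `I` starts at a prime of height at least `ht I` and coheight
-- at least `e`.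
lemma height_add_natCast_le {I : Ideal R} {d e : ℕ} (hd : ringKrullDim R = d)
    (he : ringKrullDim (R ⧸ I) = e) : I.height + e ≤ d := by
  rw [ringKrullDim_quotient] at he
  obtain ⟨q, hq⟩ := Order.le_krullDim_iff.mp he.ge
  have : Nonempty (PrimeSpectrum R) := ⟨q.head.1⟩
  have h1 : I.height ≤ Order.height q.head.1 := by
    rw [← PrimeSpectrum.height_eq_orderHeight]
    exact Ideal.height_mono q.head.2
  have h2 : (e : ℕ∞) ≤ Order.coheight q.head.1 := by
    have := Order.length_le_coheight_head (p := q.map Subtype.val fun _ _ h ↦ h)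
    rw [← hq]
    exact this
  have h3 := hd.symm.trans Order.krullDim_eq_iSup_height_add_coheight_of_nonempty
  have h4 : (d : ℕ∞) = ⨆ a : PrimeSpectrum R, Order.height a + Order.coheight a := by
    exact_mod_cast h3
  rw [h4]
  exact (add_le_add h1 h2).trans
    (le_iSup (fun a : PrimeSpectrum R ↦ Order.height a + Order.coheight a) q.head.1)

include hR in
/-- In a Cohen–Macaulay local ring, `ht I + dim R/I = dim R`. -/
lemma height_eq_natCast {I : Ideal R} (hI : I ≠ ⊤) {d e g : ℕ}
    (hd : ringKrullDim R = d) (he : ringKrullDim (R ⧸ I) = e) (hg : g + e = d) :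
    I.height = g := by
  have hd' : Module.supportDim R R = d := by rw [Module.supportDim_self_eq_ringKrullDim, hd]
  obtain ⟨rs, hlen, hmem, hrs⟩ := hR.exists_isRegular_mem hd' hI he hg
  refine le_antisymm ?_ (hlen ▸ length_le_height_of_isWeaklyRegular hrs.1 hmem)
  have := height_add_natCast_le hd he
  rw [← hg, Nat.cast_add] at this
  exact (ENat.add_le_add_iff_right (ENat.natCast_ne_top e)).mp this

end Depth

/-! ### Vanishing of `δ`: maximal Cohen–Macaulay modules without free summands -/

section Delta

open IsLocalRing RingTheory.Sequence

lemma delta_eq_zero_of_cmPart_eq_top {S : Type u} [CommRing S] [IsLocalRing S] (M : Type u)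
    [AddCommGroup M] [Module S M] (h : cmPart S M = ⊤) : delta S M = 0 := by
  have hs : Subsingleton (M ⧸ cmPart S M) := Submodule.Quotient.subsingleton_iff.mpr h
  have : (⊤ : Submodule S (M ⧸ cmPart S M)) = ⊥ := Subsingleton.elim _ _
  rw [delta, Submodule.spanRank_eq_zero_iff_eq_bot.mpr this, map_zero]

/-- A maximal Cohen–Macaulay module without free summands equals its `cm` part. -/
lemma cmPart_eq_top {S : Type u} [CommRing S] [IsLocalRing S] (M : Type u)
    [AddCommGroup M] [Module S M] (h : IsMaximalCohenMacaulay S M) (h' : HasNoFreeSummand S M) :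
    cmPart S M = ⊤ :=
  top_le_iff.mp (le_sSup ⟨M, inferInstance, inferInstance, h, h', LinearMap.id, by simp⟩)

/-- A nonzero free direct summand contains a direct summand of rank one. -/
lemma exists_leftInverse_of_free_summand {S M : Type*} [CommRing S] [Nontrivial S]
    [AddCommGroup M] [Module S M] {P Q : Submodule S M} (h : IsCompl P Q) (hP : Module.Free S P)
    (hne : P ≠ ⊥) : ∃ (f : S →ₗ[S] M) (r : M →ₗ[S] S), r ∘ₗ f = LinearMap.id := by
  have : Nontrivial P := Submodule.nontrivial_iff_ne_bot.mpr hne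
  let b := Module.Free.chooseBasis S P
  obtain ⟨i⟩ : Nonempty (Module.Free.ChooseBasisIndex S P) := b.index_nonempty
  refine ⟨P.subtype ∘ₗ LinearMap.toSpanSingleton S P (b i),
    b.coord i ∘ₗ Submodule.projectionOnto P Q h, ?_⟩
  ext
  simp [Submodule.projectionOnto_apply_left]

/-- An `R`-module annihilated by an element outside of `J` has no free summand over `R/J`. -/
lemma hasNoFreeSummand_of_smul_eq_zero {R : Type u} [CommRing R] {J : Ideal R}
    [IsLocalRing (R ⧸ J)] {M : Type u} [AddCommGroup M] [Module R M]
    [Module (R ⧸ J) M] [IsScalarTower R (R ⧸ J) M] {x : R} (hx : x ∉ J)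
    (hM : ∀ m : M, x • m = 0) : HasNoFreeSummand (R ⧸ J) M := by
  intro P Q h hP
  by_contra hne
  obtain ⟨f, r, hfr⟩ := exists_leftInverse_of_free_summand h hP hne
  refine hx (Ideal.Quotient.eq_zero_iff_mem.mp ?_)
  -- `f` sends the class of `x` to `x • f 1 = 0`, yet `r` recovers that class.
  have h1 : f (Ideal.Quotient.mk J x) = 0 := by
    have : Ideal.Quotient.mk J x = x • (1 : R ⧸ J) := by
      rw [Algebra.smul_def, mul_one]; rfl
    rw [this, LinearMap.map_smul_of_tower, hM]
  have := LinearMap.congr_fun hfr (Ideal.Quotient.mk J x)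
  simpa [h1] using this.symm

/-- With `J = 0`, a nonzero free summand of `ω` makes `R` a retract of `ω`, and finite injective
dimension passes to retracts. -/
lemma hasNoFreeSummand_of_not_isGorenstein {R : Type u} [CommRing R] [IsLocalRing R]
    (hG : ¬ IsGorenstein R) {ω : Type u} [AddCommGroup ω] [Module R ω] (hω : HasFiniteInjDim R ω)
    {J : Ideal R} (hJ : J = ⊥) [IsLocalRing (R ⧸ J)] {M : Type u} [AddCommGroup M] [Module R M]
    [Module (R ⧸ J) M] [IsScalarTower R (R ⧸ J) M] (e : M ≃ₗ[R] ω) :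
    HasNoFreeSummand (R ⧸ J) M := by
  intro P Q h hP
  by_contra hne
  obtain ⟨f, r, hfr⟩ := exists_leftInverse_of_free_summand h hP hne
  obtain ⟨n, hn⟩ := hω
  let c : (R ⧸ J) ≃ₗ[R] R := Submodule.quotEquivOfEqBot J hJ
  let i : R →ₗ[R] ω := e.toLinearMap ∘ₗ f.restrictScalars R ∘ₗ c.symm.toLinearMap
  let s : ω →ₗ[R] R := c.toLinearMap ∘ₗ r.restrictScalars R ∘ₗ e.symm.toLinearMap
  have hsi : s ∘ₗ i = LinearMap.id := by
    refine LinearMap.ext fun x ↦ ?_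
    have := LinearMap.congr_fun hfr (c.symm x)
    simp only [LinearMap.comp_apply, LinearMap.id_apply] at this
    simp [s, i, this]
  let ρ : Retract (ModuleCat.of R R) (ModuleCat.of R ω) :=
    ⟨ModuleCat.ofHom i, ModuleCat.ofHom s, by rw [← ModuleCat.ofHom_comp, hsi]; rfl⟩
  exact hG ⟨n, ρ.hasInjectiveDimensionLT (n + 1)⟩

/-- The image of `rs` is regular over `R/J`, and `rs.length ≤ dim M ≤ dim R/J ≤ rs.length` forces
equality throughout. -/
lemma isMaximalCohenMacaulay_quotient {R : Type u} [CommRing R] [IsLocalRing R]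
    [IsNoetherianRing R] {J : Ideal R} [IsLocalRing (R ⧸ J)] {M : Type u} [AddCommGroup M]
    [Module R M] [Module.Finite R M] [Nontrivial M] [Module (R ⧸ J) M] [IsScalarTower R (R ⧸ J) M]
    {rs : List R} (hmem : ∀ r ∈ rs, r ∈ maximalIdeal R) (hrs : IsWeaklyRegular M rs)
    (hdim : ringKrullDim (R ⧸ J) ≤ rs.length) : IsMaximalCohenMacaulay (R ⧸ J) M := by
  have : Module.Finite (R ⧸ J) M := Module.Finite.of_restrictScalars_finite R _ _
  have := IsLocalHom.of_surjective (Ideal.Quotient.mk J) Ideal.Quotient.mk_surjective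
  have hmem' : ∀ r ∈ rs.map (algebraMap R (R ⧸ J)), r ∈ maximalIdeal (R ⧸ J) := by
    intro r hr
    obtain ⟨s, hs, rfl⟩ := List.mem_map.mp hr
    exact fun hu ↦ hmem s hs (isUnit_of_map_unit (Ideal.Quotient.mk J) s hu)
  have hreg : IsRegular M (rs.map (algebraMap R (R ⧸ J))) :=
    RingTheory.Sequence.IsRegular.of_isWeaklyRegular_of_mem_maximalIdeal M hmem'
      ((isWeaklyRegular_map_algebraMap_iff (R ⧸ J) M rs).mpr hrs)
  have hle := Module.supportDim_le_ringKrullDim (R ⧸ J) M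
  have hge := length_le_supportDim M hreg
  rw [List.length_map] at hge
  exact ⟨isCohenMacaulay_of_isRegular hreg hmem' (by rw [List.length_map]; exact hle.trans hdim),
    hle.antisymm (hdim.trans hge)⟩

end Delta

/-! ### Exterior algebra behind the Koszul complex -/

section KoszulAlgebra

variable {R : Type u} [CommRing R]

/-- Left exterior multiplication by a vector, `⋀^p N → ⋀^{p+1} N`. -/
noncomputable def wedgeLeft {N : Type v} [AddCommGroup N] [Module R N] (a : N) (p : ℕ) :
    ⋀[R]^p N →ₗ[R] ⋀[R]^(p + 1) N :=
  (LinearMap.mulLeft R (ExteriorAlgebra.ι R a)).restrict fun z hz ↦ by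
    have := Submodule.mul_mem_mul (LinearMap.mem_range_self (ExteriorAlgebra.ι R) a) hz
    simpa [ExteriorAlgebra.exteriorPower, pow_succ'] using this

lemma koszulD_zero_comp_wedgeLeft {N : Type v} [AddCommGroup N] [Module R N]
    (f : Module.Dual R N) (a : N) :
    koszulD f 0 ∘ₗ wedgeLeft a 0 = f a • LinearMap.id := by
  ext1
  apply AlternatingMap.ext
  intro z
  apply Subtype.ext
  have h := CliffordAlgebra.contractLeft_ι_mul (Q := (0 : QuadraticForm R N)) (d := f) a
    (exteriorPower.ιMulti R 0 z : ExteriorAlgebra R N)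
  have h0 : CliffordAlgebra.contractLeft (Q := (0 : QuadraticForm R N)) f
      (exteriorPower.ιMulti R 0 z : ExteriorAlgebra R N) = 0 := by
    have : (exteriorPower.ιMulti R 0 z : ExteriorAlgebra R N) = 1 := by simp
    rw [this]
    exact CliffordAlgebra.contractLeft_one _ _
  rw [h0, mul_zero, sub_zero] at h
  exact h

/-- Contraction is an antiderivation. Thus wedging with `a` is a homotopy between multiplication by
`f a` and zero. -/
lemma koszulD_succ_comp_wedgeLeft {N : Type v} [AddCommGroup N] [Module R N]
    (f : Module.Dual R N) (a : N) (p : ℕ) :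
    wedgeLeft a p ∘ₗ koszulD f p + koszulD f (p + 1) ∘ₗ wedgeLeft a (p + 1) =
      f a • LinearMap.id := by
  refine LinearMap.ext fun z ↦ Subtype.ext ?_
  have h := CliffordAlgebra.contractLeft_ι_mul (Q := (0 : QuadraticForm R N)) (d := f) a
    (z : ExteriorAlgebra R N)
  change ExteriorAlgebra.ι R a * CliffordAlgebra.contractLeft f (z : ExteriorAlgebra R N) +
    CliffordAlgebra.contractLeft f (CliffordAlgebra.ι 0 a * (z : ExteriorAlgebra R N)) =
      f a • (z : ExteriorAlgebra R N)
  rw [h]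
  exact add_sub_cancel _ _

lemma koszulD_linearCombination {n : ℕ} (x : Fin n → R) (p : ℕ) :
    koszulD (Fintype.linearCombination R x) p =
      ∑ i, x i • koszulD (LinearMap.proj i : (Fin n → R) →ₗ[R] R) p := by
  have hx : Fintype.linearCombination R x =
      ∑ i, x i • (LinearMap.proj i : (Fin n → R) →ₗ[R] R) := by
    ext j
    simp [Fintype.linearCombination_apply, Pi.single_apply]
  refine LinearMap.ext fun z ↦ Subtype.ext ?_
  have hz : ((koszulD (Fintype.linearCombination R x) p z : ⋀[R]^p (Fin n → R)) :
      ExteriorAlgebra R (Fin n → R)) =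
      CliffordAlgebra.contractLeft (Q := (0 : QuadraticForm R (Fin n → R)))
        (Fintype.linearCombination R x) (z : ExteriorAlgebra R (Fin n → R)) := rfl
  rw [hz, hx, map_sum, LinearMap.sum_apply, LinearMap.sum_apply, Submodule.coe_sum]
  refine Finset.sum_congr rfl fun i _ ↦ ?_
  rw [map_smul]
  rfl

lemma nonempty_exteriorPower_equiv [Nontrivial R] (n p : ℕ) :
    Nonempty (⋀[R]^p (Fin n → R) ≃ₗ[R] (Fin (n.choose p) → R)) := by
  have : Module.Finite R (⋀[R]^p (Fin n → R)) := inferInstance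
  refine ⟨LinearEquiv.ofFinrankEq _ _ ?_⟩
  rw [exteriorPower.finrank_eq]
  simp

end KoszulAlgebra

/-! ### Koszul homology: annihilation, top degree, long exact sequence -/

section KoszulHomology

open Pointwise

variable {R : Type u} [CommRing R] {n : ℕ} (x : Fin n → R)
variable (M : Type u) [AddCommGroup M] [Module R M]

lemma koszulComplex_d (p : ℕ) : (koszulComplex x M).d (p + 1) p =
    ModuleCat.ofHom (LinearMap.rTensor M (koszulD (Fintype.linearCombination R x) p)) :=
  ChainComplex.of_d (fun p ↦ ModuleCat.of R ((⋀[R]^p (Fin n → R)) ⊗[R] M))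
    (fun p ↦ ModuleCat.ofHom
      (LinearMap.rTensor M (koszulD (Fintype.linearCombination R x) p))) p

lemma rTensor_koszulD_zero_wedgeLeft {N : Type v} [AddCommGroup N] [Module R N]
    (f : Module.Dual R N) (a : N) (z : (⋀[R]^0 N) ⊗[R] M) :
    LinearMap.rTensor M (koszulD f 0) (LinearMap.rTensor M (wedgeLeft a 0) z) = f a • z := by
  have h := congrArg (LinearMap.rTensor M) (koszulD_zero_comp_wedgeLeft f a)
  rw [LinearMap.rTensor_smul, LinearMap.rTensor_id, LinearMap.rTensor_comp] at h
  exact LinearMap.congr_fun h z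

lemma rTensor_koszulD_succ_wedgeLeft {N : Type v} [AddCommGroup N] [Module R N]
    (f : Module.Dual R N) (a : N) (p : ℕ) (z : (⋀[R]^(p + 1) N) ⊗[R] M) :
    LinearMap.rTensor M (wedgeLeft a p) (LinearMap.rTensor M (koszulD f p) z) +
      LinearMap.rTensor M (koszulD f (p + 1)) (LinearMap.rTensor M (wedgeLeft a (p + 1)) z) =
        f a • z := by
  have h := congrArg (LinearMap.rTensor M) (koszulD_succ_comp_wedgeLeft f a p)
  rw [LinearMap.rTensor_smul, LinearMap.rTensor_id, LinearMap.rTensor_add,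
    LinearMap.rTensor_comp, LinearMap.rTensor_comp] at h
  exact LinearMap.congr_fun h z

lemma exists_linearCombination_eq {y : R} (hy : y ∈ Ideal.span (Set.range x)) :
    ∃ a, Fintype.linearCombination R x a = y := by
  rw [Ideal.span, ← Fintype.range_linearCombination R] at hy
  exact hy

/-- A contracting homotopy for multiplication by `y` kills it on homology. -/
lemma homologyMap_smul_id_eq_zero {K : ChainComplex (ModuleCat.{u} R) ℕ} {y : R}
    (s : ∀ i, K.X i ⟶ K.X (i + 1)) (h₀ : s 0 ≫ K.d 1 0 = y • 𝟙 (K.X 0))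
    (h : ∀ i, K.d (i + 1) i ≫ s i + s (i + 1) ≫ K.d (i + 2) (i + 1) = y • 𝟙 (K.X (i + 1)))
    (p : ℕ) : HomologicalComplex.homologyMap (y • 𝟙 K) p = 0 := by
  -- The target index `j` equals `i + 1` only through a hypothesis, hence the transport.
  let t (i j : ℕ) (hij : (ComplexShape.down ℕ).Rel j i) : K.X i ⟶ K.X j :=
    s i ≫ eqToHom (congrArg K.X (show i + 1 = j from hij))
  have ht (i : ℕ) (hi : (ComplexShape.down ℕ).Rel (i + 1) i) : t i (i + 1) hi = s i :=
    Category.comp_id _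
  have hy : y • 𝟙 K = Homotopy.nullHomotopicMap' t := by
    ext1 i
    cases i with
    | zero =>
      rw [Homotopy.nullHomotopicMap'_f_of_not_rel_left (k₁ := 1) (k₀ := 0)
        (show (ComplexShape.down ℕ).Rel 1 0 from rfl) (by simp), ht _ rfl]
      exact h₀.symm
    | succ i =>
      rw [Homotopy.nullHomotopicMap'_f (k₂ := i + 2) (k₁ := i + 1) (k₀ := i)
        (show (ComplexShape.down ℕ).Rel (i + 2) (i + 1) from rfl)
        (show (ComplexShape.down ℕ).Rel (i + 1) i from rfl), ht _ rfl, ht _ rfl]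
      exact (h i).symm
  rw [hy, (Homotopy.nullHomotopy' t).homologyMap_eq, HomologicalComplex.homologyMap_zero]

/-- Multiplication by an element of the ideal is zero on Koszul homology. -/
lemma homologyMap_smul_id_koszulComplex {y : R} (hy : y ∈ Ideal.span (Set.range x)) (p : ℕ) :
    HomologicalComplex.homologyMap (y • 𝟙 (koszulComplex x M)) p = 0 := by
  obtain ⟨a, rfl⟩ := exists_linearCombination_eq x hy
  refine homologyMap_smul_id_eq_zero
    (fun i ↦ ModuleCat.ofHom (LinearMap.rTensor M (wedgeLeft a i))) ?_ (fun i ↦ ?_) p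
  · rw [koszulComplex_d]
    apply ModuleCat.hom_ext
    exact LinearMap.ext fun z ↦ rTensor_koszulD_zero_wedgeLeft M _ a z
  · rw [koszulComplex_d, koszulComplex_d]
    apply ModuleCat.hom_ext
    exact LinearMap.ext fun z ↦ rTensor_koszulD_succ_wedgeLeft M _ a i z

lemma subsingleton_koszulComplex_X [Nontrivial R] {p : ℕ} (hp : n < p) :
    Subsingleton ((koszulComplex x M).X p) := by
  obtain ⟨e⟩ := nonempty_exteriorPower_equiv (R := R) n p
  rw [Nat.choose_eq_zero_of_lt hp] at e
  have : Subsingleton (⋀[R]^p (Fin n → R)) := e.toEquiv.subsingleton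
  exact inferInstanceAs (Subsingleton ((⋀[R]^p (Fin n → R)) ⊗[R] M))

lemma subsingleton_koszulHomology_of_lt [Nontrivial R] {p : ℕ} (hp : n < p) :
    Subsingleton (koszulHomology x M p) := by
  have := subsingleton_koszulComplex_X x M hp
  exact ModuleCat.subsingleton_of_isZero (ShortComplex.isZero_homology_of_isZero_X₂ _
    (ModuleCat.isZero_of_subsingleton ((koszulComplex x M).X p)))

variable {M} in
-- Nothing lies above the top degree, so the homotopy formula reads `f(a) z = a ∧ ∂z` and cycles are
-- killed by the ideal. Conversely `∂` is an `R`-combination of contractions with coefficients `xᵢ`.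
lemma rTensor_koszulD_top_eq_zero_iff [Nontrivial R] {m : ℕ} (x : Fin (m + 1) → R)
    (z : (⋀[R]^(m + 1) (Fin (m + 1) → R)) ⊗[R] M) :
    LinearMap.rTensor M (koszulD (Fintype.linearCombination R x) m) z = 0 ↔
      ∀ y ∈ Ideal.span (Set.range x), y • z = 0 := by
  constructor
  · intro h y hy
    obtain ⟨a, rfl⟩ := exists_linearCombination_eq x hy
    have hs : Subsingleton ((⋀[R]^(m + 1 + 1) (Fin (m + 1) → R)) ⊗[R] M) :=
      subsingleton_koszulComplex_X x M (Nat.lt_succ_self (m + 1))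
    rw [← rTensor_koszulD_succ_wedgeLeft, h, map_zero,
      hs.elim (LinearMap.rTensor M (wedgeLeft a (m + 1)) z) 0, map_zero, add_zero]
  · intro h
    rw [koszulD_linearCombination, ← LinearMap.coe_rTensorHom, map_sum, LinearMap.sum_apply]
    refine Finset.sum_eq_zero fun i _ ↦ ?_
    rw [map_smul, LinearMap.smul_apply, ← map_smul, h (x i) (Ideal.subset_span ⟨i, rfl⟩), map_zero]

variable {M} in
lemma koszulComplex_d_top_eq_zero_iff [Nontrivial R] (j : ℕ)
    (hj : (ComplexShape.down ℕ).next n = j) (z : (koszulComplex x M).X n) :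
    ((koszulComplex x M).d n j).hom z = 0 ↔ ∀ y ∈ Ideal.span (Set.range x), y • z = 0 := by
  cases n with
  | zero =>
    -- For the empty sequence no differential leaves degree `0` and the ideal is zero, so both sides
    -- always hold.
    have hd : (koszulComplex x M).d 0 j = 0 := (koszulComplex x M).shape _ _ (by simp)
    have hI : Ideal.span (Set.range x) = ⊥ := by
      rw [Set.range_eq_empty, Ideal.span_empty]
    rw [hd, hI]
    refine ⟨fun _ y hy ↦ ?_, fun _ ↦ rfl⟩
    rw [Ideal.mem_bot.mp hy]
    exact zero_smul R z
  | succ m =>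
    obtain rfl : m = j := by simpa using hj
    rw [koszulComplex_d]
    exact rTensor_koszulD_top_eq_zero_iff x z

/-- The top Koszul homology with coefficients in `M` is `Hom(R/(x), M)`. -/
lemma nonempty_koszulHomology_top_equiv [Nontrivial R] {I : Ideal R}
    (hI : Ideal.span (Set.range x) = I) :
    Nonempty (koszulHomology x M n ≃ₗ[R] (R ⧸ I →ₗ[R] M)) := by
  subst hI
  set I := Ideal.span (Set.range x)
  let S := (koszulComplex x M).sc n
  have hX₁ : Subsingleton S.X₁ := by
    have : (ComplexShape.down ℕ).prev n = n + 1 := by simp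
    change Subsingleton ((koszulComplex x M).X ((ComplexShape.down ℕ).prev n))
    rw [this]
    exact subsingleton_koszulComplex_X x M (Nat.lt_succ_self n)
  have hf : S.f = 0 := (ModuleCat.isZero_of_subsingleton S.X₁).eq_zero_of_src _
  have := S.isIso_homologyπ hf
  let e₁ : koszulHomology x M n ≃ₗ[R] LinearMap.ker S.g.hom :=
    ((asIso S.homologyπ).symm ≪≫ S.moduleCatCyclesIso).toLinearEquiv
  -- Evaluation at `1` identifies `Hom(R/I, S.X₂)` with the elements killed by `I`, which are the
  -- cycles; there are no boundaries, and `S.X₂ ≅ M` because the top exterior power has rank one.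
  let ev : (R ⧸ I →ₗ[R] S.X₂) →ₗ[R] S.X₂ := LinearMap.applyₗ (1 : R ⧸ I)
  have hev : Function.Injective ev := by
    intro φ ψ h
    refine Submodule.linearMap_qext _ (LinearMap.ext_ring h)
  have hrange : LinearMap.range ev = LinearMap.ker S.g.hom := by
    ext z
    rw [LinearMap.mem_ker]
    refine Iff.trans ?_ (koszulComplex_d_top_eq_zero_iff x _ rfl z).symm
    constructor
    · rintro ⟨φ, rfl⟩ y hy
      have hy1 : y • (1 : R ⧸ I) = 0 := by
        rw [Algebra.smul_def, mul_one]
        exact Ideal.Quotient.eq_zero_iff_mem.mpr hy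
      change y • φ 1 = 0
      rw [← map_smul, hy1, map_zero]
    · intro h
      exact ⟨Submodule.liftQ I (LinearMap.toSpanSingleton R _ z) fun y hy ↦ h y hy, one_smul R z⟩
  obtain ⟨c⟩ := nonempty_exteriorPower_equiv (R := R) n n
  rw [Nat.choose_self] at c
  let e₂ : S.X₂ ≃ₗ[R] M :=
    (TensorProduct.congr (c ≪≫ₗ LinearEquiv.funUnique (Fin 1) R R) (LinearEquiv.refl R M)) ≪≫ₗ
      TensorProduct.lid R M
  exact ⟨e₁ ≪≫ₗ LinearEquiv.ofEq _ _ hrange.symm ≪≫ₗ (LinearEquiv.ofInjective ev hev).symm ≪≫ₗ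
    LinearEquiv.congrRight e₂⟩

variable {M} in
/-- The map of Koszul complexes induced by a map of coefficients. -/
noncomputable def koszulMap {M' : Type u} [AddCommGroup M'] [Module R M'] (φ : M →ₗ[R] M') :
    koszulComplex x M ⟶ koszulComplex x M' where
  f p := ModuleCat.ofHom (LinearMap.lTensor _ φ)
  comm' i j hij := by
    obtain rfl : j + 1 = i := hij
    rw [koszulComplex_d, koszulComplex_d]
    apply ModuleCat.hom_ext
    exact (LinearMap.rTensor_comp_lTensor _ _ _).trans (LinearMap.lTensor_comp_rTensor _ _ _).symm

variable {M} in
lemma exact_smul_lTensor_mkQ (A : Type u) [AddCommGroup A] [Module R A] (y : R) :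
    Function.Exact (y • LinearMap.id : A ⊗[R] M →ₗ[R] A ⊗[R] M)
      (LinearMap.lTensor A (y • (⊤ : Submodule R M)).mkQ) := by
  have h := lTensor_exact A (LinearMap.exact_lsmul_mkQ_smul_top M y) (Submodule.mkQ_surjective _)
  rwa [show LinearMap.lsmul R M y = y • LinearMap.id from rfl, LinearMap.lTensor_smul,
    LinearMap.lTensor_id] at h

/-- The short complex `K(x; M) → K(x; M) → K(x; M / yM)` given by multiplication by `y`. -/
noncomputable def koszulSMulShortComplex (y : R) : ShortComplex (ChainComplex (ModuleCat.{u} R) ℕ) :=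
  ShortComplex.mk (y • 𝟙 (koszulComplex x M))
    (koszulMap x (M' := QuotSMulTop y M) (Submodule.mkQ _)) (by
      ext1 p
      apply ModuleCat.hom_ext
      exact (exact_smul_lTensor_mkQ (⋀[R]^p (Fin n → R)) y).linearMap_comp_eq_zero)

variable {M} in
lemma koszulSMulShortComplex_shortExact {y : R} (hy : IsSMulRegular M y) :
    (koszulSMulShortComplex x M y).ShortExact := by
  apply HomologicalComplex.shortExact_of_degreewise_shortExact
  intro p
  refine ModuleCat.shortComplex_shortExact _ ?_ ?_ ?_
  · exact exact_smul_lTensor_mkQ (⋀[R]^p (Fin n → R)) y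
  · exact hy.lTensor (⋀[R]^p (Fin n → R))
  · exact LinearMap.lTensor_surjective (⋀[R]^p (Fin n → R)) (Submodule.mkQ_surjective _)

end KoszulHomology

/-! ### Comparison of Koszul homology with Ext -/

section KoszulExt

variable {R : Type u} [CommRing R]

/-- Scalars act on Ext through the first variable, where `a` is zero. -/
lemma smul_ext_quotient {I : Ideal R} {a : R} (ha : a ∈ I) (Y : ModuleCat.{u} R) (i : ℕ)
    (z : Ext (ModuleCat.of R (R ⧸ I)) Y i) : a • z = 0 := by
  have h : a • 𝟙 (ModuleCat.of R (R ⧸ I)) = 0 := by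
    apply ModuleCat.hom_ext
    refine LinearMap.ext fun w ↦ ?_
    obtain ⟨w, rfl⟩ := Ideal.Quotient.mk_surjective w
    change Ideal.Quotient.mk I (a * w) = 0
    exact Ideal.Quotient.eq_zero_iff_mem.mpr (I.mul_mem_right w ha)
  rw [← Ext.mk₀_id_comp z, ← Ext.smul_comp, ← Ext.mk₀_smul, h, Ext.mk₀_zero, Ext.zero_comp]

/-- If `y` is `M`-regular, annihilates `Ext^{i+1}(N, M)`, and `Ext^i(N, M) = 0`, then
`Ext^i(N, M / yM) ≅ Ext^{i+1}(N, M)`. -/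
lemma nonempty_ext_quotSMulTop_equiv {N M : ModuleCat.{u} R} {y : R} (hy : IsSMulRegular M y)
    (i : ℕ) (h : Subsingleton (Ext N M i)) (h' : ∀ z : Ext N M (i + 1), y • z = 0) :
    Nonempty (Ext N (ModuleCat.of R (QuotSMulTop y M)) i ≃ₗ[R] Ext N M (i + 1)) := by
  have hS := hy.smulShortComplex_shortExact
  let δ : Ext N (ModuleCat.of R (QuotSMulTop y M)) i →ₗ[R] Ext N M (i + 1) :=
    Ext.postcompOfLinear hS.extClass R N rfl
  refine ⟨LinearEquiv.ofBijective δ ⟨?_, fun z ↦ ?_⟩⟩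
  · rw [injective_iff_map_eq_zero]
    intro z hz
    obtain ⟨w, hw⟩ := Ext.covariant_sequence_exact₃ N hS z rfl hz
    rw [← hw, show w = 0 from h.elim _ _, Ext.zero_comp]
    rfl
  · refine Ext.covariant_sequence_exact₁ N hS z ?_ rfl
    change z.comp (Ext.mk₀ (y • 𝟙 M)) (add_zero (i + 1)) = 0
    rw [← Ext.smul_eq_comp_mk₀, h']

/-- If `rs` is a regular sequence on `M` in `I = (x₁, …, xₙ)` of length `g`, then
`H_p(x; M) = 0` for `p > n - g` and `H_{n-g}(x; M) ≅ Ext^g(R/I, M)`. -/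
theorem koszulHomology_equiv_ext [IsLocalRing R] [IsNoetherianRing R] {n : ℕ} (x : Fin n → R)
    {I : Ideal R} (hx : Ideal.span (Set.range x) = I) (hI : I ≠ ⊤) (rs : List R)
    (hmem : ∀ r ∈ rs, r ∈ I) (M : Type u) [AddCommGroup M] [Module R M] [Module.Finite R M]
    (hrs : RingTheory.Sequence.IsRegular M rs) (p : ℕ) (hp : p + rs.length = n) :
    (∀ q, p < q → Subsingleton (koszulHomology x M q)) ∧
      Nonempty (koszulHomology x M p ≃ₗ[R]
        Ext (ModuleCat.of R (R ⧸ I)) (ModuleCat.of R M) rs.length) := by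
  induction rs generalizing M p with
  | nil =>
    obtain rfl : p = n := by simpa using hp
    refine ⟨fun q hq ↦ subsingleton_koszulHomology_of_lt x M hq, ?_⟩
    obtain ⟨e⟩ := nonempty_koszulHomology_top_equiv x M hx
    exact ⟨e ≪≫ₗ (Ext.linearEquiv₀.trans ModuleCat.homLinearEquiv).symm⟩
  | cons y rs ih =>
    have hrs' := (RingTheory.Sequence.isRegular_cons_iff M y rs).mp hrs
    have hyI : y ∈ I := hmem y (by simp)
    have hyx : y ∈ Ideal.span (Set.range x) := hx ▸ hyI
    have hS := koszulSMulShortComplex_shortExact x hrs'.1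
    rw [List.length_cons] at hp
    obtain ⟨h₁, ⟨e⟩⟩ := ih (fun r hr ↦ hmem r (by simp [hr])) (QuotSMulTop y M) hrs'.2 (p + 1)
      (by omega)
    -- Multiplication by `y ∈ I` is zero on `H_q(x; M)`, so the connecting map `H_{q+1}(x; M/yM) →
    -- H_q(x; M)` is onto.
    have hepi (q : ℕ) : Epi (hS.δ (q + 1) q rfl) :=
      (hS.homology_exact₁ (q + 1) q rfl).epi_f (homologyMap_smul_id_koszulComplex x M hyx q)
    have hvan : ∀ q, p < q → Subsingleton (koszulHomology x M q) := by
      intro q hq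
      have h2 : Subsingleton ((koszulSMulShortComplex x M y).X₃.homology (q + 1)) :=
        h₁ (q + 1) (by omega)
      have := hepi q
      exact ((ModuleCat.epi_iff_surjective _).mp this).subsingleton
    refine ⟨hvan, ?_⟩
    -- The vanishing just proved for `H_{p+1}(x; M)` makes the connecting map injective in degree
    -- `p`; this is why vanishing is part of the induction.
    have hmono : Mono (hS.δ (p + 1) p rfl) := by
      have := hvan (p + 1) (Nat.lt_succ_self p)
      exact (hS.homology_exact₃ (p + 1) p rfl).mono_g
        ((ModuleCat.isZero_of_subsingleton (koszulHomology x M (p + 1))).eq_zero_of_src _)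
    have := hepi p
    have := isIso_of_mono_of_epi (hS.δ (p + 1) p rfl)
    let e₁ : koszulHomology x (QuotSMulTop y M) (p + 1) ≃ₗ[R] koszulHomology x M p :=
      (asIso (hS.δ (p + 1) p rfl)).toLinearEquiv
    have := hrs.nontrivial
    -- `I` contains the longer regular sequence `y :: rs`, so this Ext vanishes and dimension
    -- shifting along `y` is an isomorphism.
    have hext : Subsingleton (Ext (ModuleCat.of R (R ⧸ I)) (ModuleCat.of R M) rs.length) := by
      refine ModuleCat.subsingleton_ext_of_exists_isRegular I _ ?_ _
        (ideal_smul_top_lt_top M (IsLocalRing.le_maximalIdeal hI)) _ hmem hrs rs.length (by simp)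
      have h : Module.support R (R ⧸ I) = PrimeSpectrum.zeroLocus (I : Set R) := by
        rw [Module.support_eq_zeroLocus, Ideal.annihilator_quotient]
      exact h.subset
    obtain ⟨e₂⟩ := nonempty_ext_quotSMulTop_equiv (N := ModuleCat.of R (R ⧸ I))
      (M := ModuleCat.of R M) hrs'.1 rs.length hext (smul_ext_quotient hyI _ _)
    exact ⟨e₁.symm ≪≫ₗ e ≪≫ₗ e₂⟩

end KoszulExt

/-! ### Ext into `ω` and the vanishing of its `δ` -/

section DualizingExt

open IsLocalRing

variable {R : Type u} [CommRing R] [IsLocalRing R] [IsNoetherianRing R]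

/-- Over a Cohen–Macaulay ring `R` of dimension `d`, if `ω` is maximal Cohen–Macaulay of finite
injective dimension and `R/I` is Cohen–Macaulay of codimension `g`, then `Ext^i(R/I, ω) = 0` for
`i ≠ g` and `Ext^g(R/I, ω)` has a regular sequence of length `dim R/I`. -/
lemma ext_quotient_dualizing (hR : IsCohenMacaulay R R) {ω : Type u} [AddCommGroup ω] [Module R ω]
    (hω : IsMaximalCohenMacaulay R ω) (hinj : HasFiniteInjDim R ω) {I : Ideal R}
    (hI : IsCohenMacaulay R (R ⧸ I)) {d e g : ℕ} (hd : ringKrullDim R = d)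
    (he : ringKrullDim (R ⧸ I) = e) (hg : g + e = d) :
    (∀ i, i ≠ g → Subsingleton (Ext (ModuleCat.of R (R ⧸ I)) (ModuleCat.of R ω) i)) ∧
      ∃ rs : List R, rs.length = e ∧ (∀ r ∈ rs, r ∈ maximalIdeal R) ∧
        RingTheory.Sequence.IsWeaklyRegular
          (Ext (ModuleCat.of R (R ⧸ I)) (ModuleCat.of R ω) g) rs := by
  have := hω.finite
  have hdR : Module.supportDim R R = d := by rw [Module.supportDim_self_eq_ringKrullDim, hd]
  have hdω : Module.supportDim R ω = d := by rw [hω.dim_eq_dim, hd]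
  have heI : Module.supportDim R (R ⧸ I) = e := by
    rw [Module.supportDim_quotient_eq_ringKrullDim, he]
  obtain ⟨n, hn⟩ := hinj
  obtain ⟨xs, hxlen, hxmem, hxs⟩ := hR.exists_isRegular hdR
  obtain ⟨rs, hlen, hmem, hrs⟩ := hI.exists_isRegular heI
  have hbass := fun i (hi : d < i) ↦ subsingleton_ext_of_lt_of_hasInjectiveDimension
    (Y := ModuleCat.of R ω) hn hxs hxmem (by rw [hd, hxlen]) i (by omega)
  have hdepth := hω.toIsCohenMacaulay.subsingleton_ext_residueField hdω
  refine ⟨fun i hi ↦ ?_, rs, hlen, hmem, isWeaklyRegular_ext hbass hdepth rs hmem _ hrs.1 g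
    (by rw [heI, hlen]) (by omega)⟩
  -- Below `g` Ischebeck applies; above it, `rs` lowers Bass' bound from `d` to `d - e = g`.
  rcases lt_or_gt_of_ne hi with hi | hi
  · refine subsingleton_ext_of_supportDim_lt hdepth (e + 1) _ inferInstance ?_ i (by omega)
    rw [heI]
    exact_mod_cast Nat.lt_succ_self e
  · exact subsingleton_ext_of_isWeaklyRegular hbass rs hmem _ hrs.1 i (by omega)

omit [IsLocalRing R] [IsNoetherianRing R] in
lemma ringKrullDim_quotient_of_eq_bot {I : Ideal R} (hI : I = ⊥) :
    ringKrullDim (R ⧸ I) = ringKrullDim R := by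
  rw [← Module.supportDim_quotient_eq_ringKrullDim, ← Module.supportDim_self_eq_ringKrullDim,
    Module.supportDim_eq_of_equiv (Submodule.quotEquivOfEqBot I hI)]

/-- `δ_{R/J}` vanishes on `Ext^i(R/I, ω)`. -/
lemma deltaQuotient_eq_zero_of_equiv_ext (hR : IsCohenMacaulay R R) {ω : Type u} [AddCommGroup ω]
    [Module R ω] (hω : IsMaximalCohenMacaulay R ω) (hinj : HasFiniteInjDim R ω) {I J : Ideal R}
    (hI : IsCohenMacaulay R (R ⧸ I)) (hI0 : IsGorenstein R → I ≠ ⊥) (hJI : J ≤ I)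
    (hdim : ringKrullDim (R ⧸ J) = ringKrullDim (R ⧸ I)) (hJ : J = I → I = ⊥)
    [IsLocalRing (R ⧸ J)] (i : ℕ) (M : Type u) [AddCommGroup M] [Module R M]
    (φ : M ≃ₗ[R] Ext (ModuleCat.of R (R ⧸ I)) (ModuleCat.of R ω) i) :
    ∃ h : Module.IsTorsionBySet R M J, deltaQuotient J M h = 0 := by
  have := hω.finite
  have := hI.nontrivial
  have hkill {a : R} (ha : a ∈ I) (m : M) : a • m = 0 :=
    φ.injective (by rw [map_smul, smul_ext_quotient ha, map_zero])
  have htors : Module.IsTorsionBySet R M J := fun m a ↦ hkill (hJI a.2) m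
  refine ⟨htors, ?_⟩
  let := htors.module
  have : IsScalarTower R (R ⧸ J) M := htors.isScalarTower
  refine delta_eq_zero_of_cmPart_eq_top M ?_
  rcases subsingleton_or_nontrivial M with hM | hM
  · exact Subsingleton.elim _ _
  obtain ⟨d, hd⟩ := exists_supportDim_eq_natCast (R := R) R
  obtain ⟨e, he⟩ := exists_supportDim_eq_natCast (R := R) (R ⧸ I)
  rw [Module.supportDim_self_eq_ringKrullDim] at hd
  rw [Module.supportDim_quotient_eq_ringKrullDim] at he
  have hed : e ≤ d := by
    have := ringKrullDim_quotient_le I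
    rw [hd, he] at this
    exact_mod_cast this
  obtain ⟨g, hg⟩ : ∃ g, g + e = d := ⟨d - e, by omega⟩
  obtain ⟨hvan, rs, hlen, hmem, hrs⟩ := ext_quotient_dualizing hR hω hinj hI hd he hg
  obtain rfl : i = g := by
    by_contra hne
    have := hvan i hne
    exact not_subsingleton M φ.toEquiv.subsingleton
  have : Module.Finite R M := Module.Finite.equiv φ.symm
  refine cmPart_eq_top M (isMaximalCohenMacaulay_quotient hmem
    ((φ.isWeaklyRegular_congr rs).mpr hrs) (by rw [hdim, he, hlen])) ?_
  -- If `J = I`, then `I = 0`, the degree is `0` and `M ≅ Hom(R, ω) ≅ ω`. Otherwise an element of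
  -- `I` outside `J` kills `M`.
  by_cases hJI' : J = I
  · have hbot := hJ hJI'
    obtain rfl : i = 0 := by
      rw [ringKrullDim_quotient_of_eq_bot hbot, hd] at he
      have : d = e := by exact_mod_cast he
      omega
    exact hasNoFreeSummand_of_not_isGorenstein (fun hG ↦ hI0 hG hbot) hinj (hJI'.trans hbot)
      (φ ≪≫ₗ (Ext.linearEquiv₀.trans ModuleCat.homLinearEquiv) ≪≫ₗ
        LinearEquiv.arrowCongr (Submodule.quotEquivOfEqBot I hbot) (LinearEquiv.refl R ω) ≪≫ₗ
        LinearMap.ringLmapEquivSelf R R ω)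
  · obtain ⟨x, hxI, hxJ⟩ := SetLike.exists_of_lt (lt_of_le_of_ne hJI hJI')
    exact hasNoFreeSummand_of_smul_eq_zero hxJ (hkill hxI)

end DualizingExt

end DeltaInv

/-! ### The main theorem -/

theorem theorem3p2 {R : Type u} [CommRing R] [IsLocalRing R] [IsNoetherianRing R]
    (hR : DeltaInv.IsCohenMacaulay R R)
    (ω : Type u) [AddCommGroup ω] [Module R ω] (hω : DeltaInv.IsCanonicalModule R ω)
    (I : Ideal R) (hI : DeltaInv.IsCohenMacaulay R (R ⧸ I))
    (hI0 : DeltaInv.IsGorenstein R → I ≠ ⊥) :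
    ∃ J : Ideal R, J ≤ I ∧ DeltaInv.IsCohenMacaulay R (R ⧸ J) ∧
      ∃ _ : IsLocalRing (R ⧸ J),
        (∀ i : ℕ,
          ∃ h : Module.IsTorsionBySet R
              (Ext (ModuleCat.of R (R ⧸ I)) (ModuleCat.of R ω) i) J,
            DeltaInv.deltaQuotient J
              (Ext (ModuleCat.of R (R ⧸ I)) (ModuleCat.of R ω) i) h = 0) ∧
        (∀ x : Fin I.spanFinrank → R, Ideal.span (Set.range x) = I →
          ∃ h : Module.IsTorsionBySet R
              (DeltaInv.koszulHomology x ω (I.spanFinrank - I.height.toNat)) J,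
            DeltaInv.deltaQuotient J
              (DeltaInv.koszulHomology x ω (I.spanFinrank - I.height.toNat)) h = 0) := by
  have hI' : I ≠ ⊤ := Ideal.Quotient.nontrivial_iff.mp hI.nontrivial
  have := hω.finite
  obtain ⟨d, hd⟩ := DeltaInv.exists_supportDim_eq_natCast (R := R) R
  have := hI.nontrivial
  obtain ⟨e, he⟩ := DeltaInv.exists_supportDim_eq_natCast (R := R) (R ⧸ I)
  rw [Module.supportDim_self_eq_ringKrullDim] at hd
  rw [Module.supportDim_quotient_eq_ringKrullDim] at he
  have hed : e ≤ d := by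
    have := ringKrullDim_quotient_le I
    rw [hd, he] at this
    exact_mod_cast this
  obtain ⟨g, hg⟩ : ∃ g, g + e = d := ⟨d - e, by omega⟩
  obtain ⟨J, hJI, hJ, hJdim, hJbot⟩ :=
    DeltaInv.exists_isCohenMacaulay_quotient_le hR hI' hd he hg
  have := hJ.nontrivial
  have hloc : IsLocalRing (R ⧸ J) :=
    IsLocalRing.of_surjective' (Ideal.Quotient.mk J) Ideal.Quotient.mk_surjective
  -- This covers every module isomorphic to some `Ext^i(R/I, ω)`, hence the Koszul homology as well.
  have key := DeltaInv.deltaQuotient_eq_zero_of_equiv_ext hR hω.toIsMaximalCohenMacaulay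
    hω.finiteInjDim hI hI0 hJI (hJdim.trans he.symm) hJbot
  refine ⟨J, hJI, hJ, hloc, fun i ↦ key i _ (LinearEquiv.refl R _), fun x hx ↦ ?_⟩
  have hht := DeltaInv.height_eq_natCast hR hI' hd he hg
  obtain ⟨rs, hlen, hmem, hrs⟩ := hω.toIsCohenMacaulay.exists_isRegular_mem
    (hω.dim_eq_dim.trans hd) hI' he hg
  -- By Krull's height theorem the truncated subtraction `μ(I) - ht I` is a genuine one.
  have hgn : g ≤ I.spanFinrank := by
    have := I.height_le_spanFinrank hI'
    rw [hht] at this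
    exact_mod_cast this
  obtain ⟨-, ⟨φ⟩⟩ := DeltaInv.koszulHomology_equiv_ext x hx hI' rs hmem ω hrs
    (I.spanFinrank - I.height.toNat) (by rw [hht, ENat.toNat_natCast, hlen]; omega)
  exact key _ _ φ
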